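/- **Conventions.** For a $\mathbb{C}$-algebra $A$, let $\mathrm{Hilb}^{n}(\mathbb{C}^d)(A)$ be the set of ideals $I\subset A[x_1,\dots,x_d]$ such that $A[x_1,\dots,x_d]/I$ is a locally free $A$-module of finite rank $n$; a homomorphism $A\to B$ acts by extension of ideals. The Hilbert scheme $\mathrm{Hilb}^{n}(\mathbb{C}^d)$ is the $\mathbb{C}$-scheme whose functor of points on $\mathbb{C}$-algebras is this functor. Let $V_d\subset \mathrm{Hilb}^{d+1}(\mathbb{C}^d)$ be the symmetric affine open subscheme: it consists of all points $h$ whose ideal $I\subset\kappa(h)[x_1,\dots,x_d]$ has the property that $1,x_1,\dots,x_d$ is a $\kappa(h)$-basis of $\kappa(h)[x_1,\dots,x_d]/I$. Equivalently, it represents the subfunctor of those $I\subset A[x_1,\dots,x_d]$ for which $1,x_1,\dots,x_d$ is an $A$-basis of $A[x_1,\dots,x_d]/I$. **Proposition.** Let $d\ge 2$ and let $R_d$ be the polynomial ring over $\mathbb{C}$ in $d\left(\binom{d+1}{2}-1\right)$ variables. There is a homogeneous ideal $I_d\subset R_d$, generated by homogeneous polynomials of degree $2$, with $I_2=(0)$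 when $d=2$, such that the following holds. 1. The functor $A\mapsto\{I\subset A[x_1,\dots,x_d] : 1,x_1,\dots,x_d \text{ is an } A\text{-basis of } A[x_1,\dots,x_d]/I\}$ is an open subfunctor of $\mathrm{Hilb}^{d+1}(\mathbb{C}^d)$, and it is represented by the $\mathbb{C}$-scheme $\mathbb{C}^d\times_{\mathbb{C}}\mathrm{Spec}(R_d/I_d)$. 2. The set of points of the Hilbert scheme $\mathrm{Hilb}^{d+1}(\mathbb{C}^d)$ defining $V_d$ is open, and, as schemes over $\mathbb{C}$, $$V_d\;\cong\;\mathbb{C}^d\times_{\mathbb{C}}\mathrm{Spec}(R_d/I_d).$$ -/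

import Mathlib

open CategoryTheory CategoryTheory.Limits AlgebraicGeometry
open scoped TensorProduct

noncomputable section

namespace HilbertPoints

/-! ### Base change of ideals of polynomial rings -/

section BaseChange

theorem map_eq_map_map {A B P S T : Type*} [CommRing A] [CommRing B] [CommRing P] [CommRing S]
    [CommRing T] [Algebra A P] [Algebra A T] [Algebra B S] [Algebra B T]
    (f : P →+* S) (g : P →ₐ[A] T) (e : T ≃ₐ[B] S)
    (h : ∀ p, e (g p) = f p) (I : Ideal P) : I.map f = (I.map g).map (e : T →+* S) := by
  apply le_antisymm
  · refine Ideal.map_le_iff_le_comap.mpr fun p hp => ?_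
    rw [Ideal.mem_comap, ← h]
    exact Ideal.mem_map_of_mem (e : T →+* S) (Ideal.mem_map_of_mem g hp)
  · refine Ideal.map_le_iff_le_comap.mpr (Ideal.map_le_iff_le_comap.mpr fun p hp => ?_)
    have h1 := Ideal.mem_map_of_mem f hp
    rw [← h] at h1
    exact h1

variable {σ A B : Type*} [CommRing A] [CommRing B] [Algebra A B]

theorem algebraTensorAlgEquiv_one_tmul (p : MvPolynomial σ A) :
    MvPolynomial.algebraTensorAlgEquiv A B (1 ⊗ₜ[A] p) =
      MvPolynomial.map (algebraMap A B) p := by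
  simp

/-- For an ideal `I` of `A[x]`, the algebra `B[x] / I B[x]` is the base change of `A[x] / I`. -/
def quotientBaseChange (I : Ideal (MvPolynomial σ A)) :
    B ⊗[A] (MvPolynomial σ A ⧸ I) ≃ₐ[B]
      MvPolynomial σ B ⧸ I.map (MvPolynomial.map (algebraMap A B)) :=
  (Algebra.TensorProduct.tensorQuotientEquiv B (MvPolynomial σ A) B I).trans
    (Ideal.quotientEquivAlg _ _ (MvPolynomial.algebraTensorAlgEquiv A B)
      (map_eq_map_map _ _ _ algebraTensorAlgEquiv_one_tmul I))

theorem quotientBaseChange_one_tmul_mk (I : Ideal (MvPolynomial σ A)) (p : MvPolynomial σ A) :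
    quotientBaseChange (B := B) I (1 ⊗ₜ Ideal.Quotient.mk I p) =
      Ideal.Quotient.mk _ (MvPolynomial.map (algebraMap A B) p) := by
  rw [← algebraTensorAlgEquiv_one_tmul]
  rfl

end BaseChange

/-! ### The Hilbert functor of points of affine space -/

/-- The quotient of `A[x_1, …, x_d]` by the ideal `I` is a locally free `A`-module of finite
rank `n`, that is, `I` defines a closed subscheme of `𝔸^d` over `Spec A` which is finite and flat
of degree `n` over `Spec A`. If `A` is a field, this says that `I` has colength `n`. -/
structure HasColength {d : ℕ} {A : Type*} [CommRing A] (n : ℕ)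
    (I : Ideal (MvPolynomial (Fin d) A)) : Prop where
  finite : Module.Finite A (MvPolynomial (Fin d) A ⧸ I)
  projective : Module.Projective A (MvPolynomial (Fin d) A ⧸ I)
  rank : ∀ p : PrimeSpectrum A, Module.rankAtStalk (MvPolynomial (Fin d) A ⧸ I) p = n

/-- The family `1, x_1, …, x_d` in `A[x_1, …, x_d] / I`. -/
def oneAndCoords {d : ℕ} {A : Type*} [CommRing A] (I : Ideal (MvPolynomial (Fin d) A)) :
    Option (Fin d) → MvPolynomial (Fin d) A ⧸ I
  | none => 1
  | some i => Ideal.Quotient.mk I (MvPolynomial.X i)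

/-- `1, x_1, …, x_d` is an `A`-basis of `A[x_1, …, x_d] / I`. -/
structure IsSymmetric {d : ℕ} {A : Type*} [CommRing A]
    (I : Ideal (MvPolynomial (Fin d) A)) : Prop where
  linearIndependent : LinearIndependent A (oneAndCoords I)
  span_eq_top : Submodule.span A (Set.range (oneAndCoords I)) = ⊤

theorem HasColength.map {d n : ℕ} {A B : Type*} [CommRing A] [CommRing B] (f : A →+* B)
    {I : Ideal (MvPolynomial (Fin d) A)} (h : HasColength n I) :
    HasColength n (I.map (MvPolynomial.map f)) := by
  algebraize [f]
  have := h.finite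
  have := h.projective
  let e := (quotientBaseChange (B := B) I).toLinearEquiv
  refine ⟨Module.Finite.equiv e, Module.Projective.of_equiv e, fun p => ?_⟩
  have h1 := congrFun (Module.rankAtStalk_eq_of_equiv e) p
  rw [Module.rankAtStalk_baseChange, h.rank] at h1
  exact h1.symm

theorem IsSymmetric.map {d : ℕ} {A B : Type*} [CommRing A] [CommRing B] (f : A →+* B)
    {I : Ideal (MvPolynomial (Fin d) A)} (h : IsSymmetric I) :
    IsSymmetric (I.map (MvPolynomial.map f)) := by
  algebraize [f]
  let b := ((Module.Basis.mk h.linearIndependent h.span_eq_top.ge).baseChange B).map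
    (quotientBaseChange (B := B) I).toLinearEquiv
  have hb : ⇑b = oneAndCoords (I.map (MvPolynomial.map f)) := by
    funext i
    have h0 : b i = quotientBaseChange (B := B) I (1 ⊗ₜ oneAndCoords I i) := by simp [b]
    rw [h0]
    cases i with
    | none => exact map_one (quotientBaseChange (B := B) I)
    | some i =>
      refine (quotientBaseChange_one_tmul_mk I _).trans ?_
      rw [MvPolynomial.map_X]
      rfl
  exact ⟨hb ▸ b.linearIndependent, hb ▸ b.span_eq⟩

/-- The Hilbert functor of `n` points in affine `d`-space over `ℂ`: it sends a `ℂ`-algebra `A` to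
the set of ideals of `A[x_1, …, x_d]` whose quotient is locally free of rank `n` over `A`, and a
homomorphism `A → B` to the extension of ideals from `A[x]` to `B[x]`. -/
def hilbFunctor (d n : ℕ) : CommAlgCat.{0} ℂ ⥤ Type where
  obj A := {I : Ideal (MvPolynomial (Fin d) A) // HasColength n I}
  map {A B} f := ↾fun I => ⟨I.1.map (MvPolynomial.map f.hom.toRingHom), I.2.map _⟩
  map_id A := by
    ext I : 3
    refine Subtype.ext ?_
    refine Eq.trans (congrArg (fun g => Ideal.map g I.1) ?_) (Ideal.map_id I.1)
    exact MvPolynomial.ringHom_ext (by simp) (by simp)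
  map_comp {A B C} f g := by
    ext I : 3
    refine Subtype.ext ?_
    refine Eq.trans (congrArg (fun g => Ideal.map g I.1) ?_) (Ideal.map_map
      (MvPolynomial.map f.hom.toRingHom) (MvPolynomial.map g.hom.toRingHom)).symm
    exact MvPolynomial.ringHom_ext (by simp) (by simp)

/-- The subfunctor of the Hilbert functor of `d + 1` points in affine `d`-space consisting of the
ideals `I` such that `1, x_1, …, x_d` is a basis of the quotient by `I`. -/
def symFunctor (d : ℕ) : Subfunctor (hilbFunctor d (d + 1)) where
  obj _ := {I | IsSymmetric I.1}
  map _ _ hI := IsSymmetric.map _ hI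

/-- A subfunctor `G` of a functor `F` on `ℂ`-algebras is open if for each `x ∈ F(A)` there is an
open subset `U` of `Spec A` such that `Spec B → Spec A` factors through `U` if and only if `x`
is mapped into `G(B)`. -/
def IsOpenSubfunctor {F : CommAlgCat.{0} ℂ ⥤ Type} (G : Subfunctor F) : Prop :=
  ∀ (A : CommAlgCat.{0} ℂ) (x : F.obj A), ∃ U : TopologicalSpace.Opens (PrimeSpectrum A),
    ∀ (B : CommAlgCat.{0} ℂ) (f : A ⟶ B),
      F.map f x ∈ G.obj B ↔ Set.range (PrimeSpectrum.comap f.hom.toRingHom) ⊆ U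

/-- The polynomial ring over `ℂ` in `d (binom(d + 1, 2) - 1)` variables. -/
abbrev polyRing (d : ℕ) : Type := MvPolynomial (Fin (d * ((d + 1).choose 2 - 1))) ℂ

/-! ### Schemes over `ℂ` -/

/-- Schemes over `ℂ`. -/
abbrev SchC : Type 1 := Over (Spec (CommRingCat.of ℂ))

/-- The functor of points `A ↦ Hom_ℂ(Spec A, X)` of a scheme `X` over `ℂ`, on `ℂ`-algebras. -/
def functorOfPoints (X : SchC) : CommAlgCat.{0} ℂ ⥤ Type :=
  (algSpec (CommRingCat.of ℂ)).rightOp ⋙ yoneda.obj X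

/-- The affine scheme `Spec A` over `ℂ`. -/
def specC (A : Type) [CommRing A] [Algebra ℂ A] : SchC :=
  Over.mk (Spec.map (CommRingCat.ofHom (algebraMap ℂ A)))

/-- The affine space `ℂ^d`. -/
def affineSpaceC (d : ℕ) : SchC :=
  Over.mk (𝔸(Fin d; Spec (CommRingCat.of ℂ)) ↘ Spec (CommRingCat.of ℂ))

/-- The product `X ×_ℂ Y`. -/
def prodC (X Y : SchC) : SchC :=
  Over.mk (pullback.fst X.hom Y.hom ≫ X.hom)

/-- The open subscheme of `X` on the open set `U`. -/
def openC (X : SchC) (U : X.left.Opens) : SchC :=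
  Over.mk (U.ι ≫ X.hom)

/-- The residue field of `X` at `x` as a `ℂ`-algebra. -/
def residueAlg (X : SchC) (x : X.left) : CommAlgCat.{0} ℂ :=
  letI : Algebra ℂ (X.left.residueField x) :=
    (Spec.preimage (X.left.fromSpecResidueField x ≫ X.hom)).hom.toAlgebra
  CommAlgCat.of ℂ (X.left.residueField x)

/-- The canonical point `Spec κ(x) → X`. -/
def residuePoint (X : SchC) (x : X.left) : (functorOfPoints X).obj (residueAlg X x) :=
  Over.homMk (U := (algSpec (CommRingCat.of ℂ)).obj (.op (residueAlg X x)))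
    (X.left.fromSpecResidueField x)
    (Spec.map_preimage (X.left.fromSpecResidueField x ≫ X.hom)).symm

/-- A scheme `H` over `ℂ` is the Hilbert scheme of `n` points in `ℂ^d` if it is equipped with an
isomorphism of its functor of points with the Hilbert functor. -/
abbrev HilbertSchemeStructure (d n : ℕ) (H : SchC) : Type 1 :=
  functorOfPoints H ≅ hilbFunctor d n

/-- The locus in the Hilbert scheme `H` of `d + 1` points in `ℂ^d` of those points `h` whose
corresponding ideal `I` of `κ(h)[x_1, …, x_d]` has the property that `1, x_1, …, x_d` is
a basis of the quotient by `I`. -/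
def symLocus {d : ℕ} {H : SchC} (e : HilbertSchemeStructure d (d + 1) H) : Set H.left :=
  {h | e.hom.app (residueAlg H h) (residuePoint H h) ∈ (symFunctor d).obj (residueAlg H h)}

end HilbertPoints

end

open CategoryTheory CategoryTheory.Limits AlgebraicGeometry
open scoped TensorProduct

noncomputable section

namespace HilbertPoints

/-! ### Multiplication tables -/

section MultTable

variable {ι A : Type*} [Fintype ι] [CommRing A]

/-! An ideal with basis `1, x_1, …, x_d` of its quotient is the same as a multiplication table for
the products `x_i x_j`. Since 2 is invertible, a unique translation `x_i - t_i` removes the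
coefficient of `x_k` from every `x_k²`. The `t_i` are the coordinates of the factor `ℂ^d`; the
remaining linear coefficients `c i j k` are the variables of `R_d`.

The constant coefficients carry no information. Comparing coefficients of `x_i` in `x_i (x_j x_k) =
(x_i x_j) x_k` for `i ≠ k`, which is possible as `d ≥ 2`, expresses `c₀ j k` as a quadratic form in
the `c`. Eliminating `c₀` leaves homogeneous quadrics, namely `IsSolution`; for `d = 2` they vanish
identically. Once the linear parts of all associators vanish, the constant parts vanish too, by the
cocycle identity for associators (`tableMul_assoc`). Hence every solution comes from an algebra, and
its table ideal is symmetric (`IsMultTable.isSymmetric`). With `IsSymmetric.exists_table` and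
`IsSymmetric.table_unique` this shows that `univRing` represents the symmetric ideals
(`map_univIdeal_bijective`).

Openness holds because, in a quotient locally free of rank `d + 1`, the `d + 1` elements form a
basis as soon as they generate, and the failure to generate is the support of a finite module.
Finally `nonempty_openC_iso` passes from open subfunctors to open subschemes: the open locus in `H`
and `Spec` of `univRing` have the same points in all `ℂ`-algebras, so they are isomorphic. -/

/-- For an algebra with basis `1, x_i` and multiplication `x_i x_j = … + ∑ k, c i j k x_k`, the
part of the coefficient of `x_m` in `x_i (x_j x_k) - (x_i x_j) x_k` which does not involve the
constant coefficients of the products `x_i x_j`. -/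
def assocDefect (c : ι → ι → ι → A) (i j k m : ι) : A :=
  ∑ l, c j k l * c i l m - ∑ l, c i j l * c k l m

theorem assocDefect_map {B : Type*} [CommRing B] (f : A →+* B) (c : ι → ι → ι → A)
    (i j k m : ι) :
    assocDefect (fun i j k => f (c i j k)) i j k m = f (assocDefect c i j k m) := by
  simp [assocDefect]

/-- The quadratic equations on the linear coefficients `c` of the products of the `x_i` which
express that the `x_i` together with `1` are the basis of a commutative associative algebra. -/
structure IsSolution (c : ι → ι → ι → A) : Prop where
  comm : ∀ i j k, c i j k = c j i k
  off_diag : ∀ i j k m, m ≠ i → m ≠ k → assocDefect c i j k m = 0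
  diag : ∀ i j k i', i ≠ k → i' ≠ j → assocDefect c i j k i = assocDefect c i' k j i'

theorem assocDefect_antisymm {c : ι → ι → ι → A} (hc : ∀ i j k, c i j k = c j i k)
    (i j k m : ι) : assocDefect c i j k m = - assocDefect c k j i m := by
  simp only [assocDefect, neg_sub]
  simp only [hc j k, hc i j]

/-- The multiplication table `x_i x_j = c₀ i j + ∑ k, c i j k x_k` is commutative, and
associative up to constants. -/
structure IsMultTable [DecidableEq ι] (c₀ : ι → ι → A) (c : ι → ι → ι → A) : Prop where
  comm_const : ∀ i j, c₀ i j = c₀ j i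
  comm : ∀ i j k, c i j k = c j i k
  assoc : ∀ i j k m, assocDefect c i j k m + (if i = m then c₀ j k else 0)
    - (if k = m then c₀ i j else 0) = 0

variable [Nontrivial ι]

/-- An index different from a given one. -/
def otherIndex (k : ι) : ι := (exists_ne k).choose

omit [Fintype ι] in
theorem otherIndex_ne (k : ι) : otherIndex k ≠ k := (exists_ne k).choose_spec

/-- The constant coefficient of `x_j x_k`, expressed by the linear coefficients. -/
def constCoeff (c : ι → ι → ι → A) (j k : ι) : A :=
  - assocDefect c (otherIndex k) j k (otherIndex k)

theorem constCoeff_map {B : Type*} [CommRing B] (f : A →+* B) (c : ι → ι → ι → A) (j k : ι) :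
    constCoeff (fun i j k => f (c i j k)) j k = f (constCoeff c j k) := by
  rw [constCoeff, assocDefect_map, constCoeff, map_neg]

variable [DecidableEq ι]

/-- The value `-c₀ j k` has to be the defect at `(i, j, k, i)` for every `i ≠ k`. The equations
`diag` say both that this value does not depend on `i` and that it is symmetric in `j, k`. The case
`m = k` reduces to `m = i` by antisymmetry of the defect. -/
theorem IsSolution.isMultTable {c : ι → ι → ι → A} (h : IsSolution c) :
    IsMultTable (constCoeff c) c := by
  have h0 : ∀ i j k, i ≠ k → assocDefect c i j k i = - constCoeff c j k := by
    intro i j k hik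
    -- `diag` also swaps `j` and `k`, so independence of `i` takes two applications, through the
    -- pair `(k, j)` and back.
    rw [constCoeff, neg_neg, h.diag i j k _ hik (otherIndex_ne j),
      ← h.diag (otherIndex k) j k _ (otherIndex_ne k) (otherIndex_ne j)]
  have hs : ∀ i j, constCoeff c i j = constCoeff c j i := by
    intro i j
    rw [constCoeff, constCoeff, h.diag _ _ _ _ (otherIndex_ne j) (otherIndex_ne i)]
  refine ⟨hs, h.comm, fun i j k m => ?_⟩
  by_cases hik : i = k
  · subst hik
    have : assocDefect c i j i m = 0 := by
      simp only [assocDefect, h.comm i j, sub_self]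
    rw [this, hs i j]
    ring
  by_cases him : i = m
  · subst him
    rw [h0 i j k hik, if_pos rfl, if_neg (Ne.symm hik)]
    ring
  by_cases hkm : k = m
  · subst hkm
    rw [assocDefect_antisymm h.comm, h0 k j i (Ne.symm hik), if_neg hik, if_pos rfl, hs i j]
    ring
  · rw [h.off_diag i j k m (Ne.symm him) (Ne.symm hkm), if_neg him, if_neg hkm]
    ring

theorem IsMultTable.constCoeff_eq {c₀ : ι → ι → A} {c : ι → ι → ι → A}
    (h : IsMultTable c₀ c) : constCoeff c = c₀ := by
  funext j k
  have h1 := h.assoc (otherIndex k) j k (otherIndex k)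
  rw [if_pos rfl, if_neg (otherIndex_ne k).symm] at h1
  rw [constCoeff]
  linear_combination -h1

omit [Nontrivial ι] in
theorem IsMultTable.isSolution {c₀ : ι → ι → A} {c : ι → ι → ι → A}
    (h : IsMultTable c₀ c) : IsSolution c := by
  refine ⟨h.comm, fun i j k m hi hk => ?_, fun i j k i' hi hi' => ?_⟩
  · simpa [hi.symm, hk.symm] using h.assoc i j k m
  · have h1 := h.assoc i j k i
    have h2 := h.assoc i' k j i'
    rw [if_pos rfl, if_neg hi.symm] at h1
    rw [if_pos rfl, if_neg hi'.symm] at h2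
    linear_combination h1 - h2 - h.comm_const j k

/-! ### The multiplication of a table and its associativity -/

/-- The products of the basis elements `1, x_i` which are prescribed by a multiplication table. -/
def basisProd {M : Type*} [AddCommGroup M] [Module A M] (b : Module.Basis (Option ι) A M)
    (c₀ : ι → ι → A) (c : ι → ι → ι → A) : Option ι → Option ι → M
  | none, o => b o
  | some i, none => b (some i)
  | some i, some j => c₀ i j • b none + ∑ k, c i j k • b (some k)

/-- The multiplication prescribed by a multiplication table. -/
def tableMul {M : Type*} [AddCommGroup M] [Module A M] (b : Module.Basis (Option ι) A M)
    (c₀ : ι → ι → A) (c : ι → ι → ι → A) : M →ₗ[A] M →ₗ[A] M :=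
  b.constr A fun o => b.constr A fun o' => basisProd b c₀ c o o'

section

variable {M : Type*} [AddCommGroup M] [Module A M] (b : Module.Basis (Option ι) A M)
    {c₀ : ι → ι → A} {c : ι → ι → ι → A}

omit [Nontrivial ι] [DecidableEq ι] in
theorem tableMul_basis (o o' : Option ι) :
    tableMul b c₀ c (b o) (b o') = basisProd b c₀ c o o' := by
  rw [tableMul, Module.Basis.constr_basis, Module.Basis.constr_basis]

omit [Nontrivial ι] [DecidableEq ι] in
theorem tableMul_one_left (x : M) : tableMul b c₀ c (b none) x = x := by
  have : tableMul b c₀ c (b none) = LinearMap.id :=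
    b.ext fun o => by rw [tableMul_basis]; rfl
  rw [this]
  rfl

omit [Nontrivial ι] in
theorem tableMul_comm (h : IsMultTable c₀ c) (x y : M) :
    tableMul b c₀ c x y = tableMul b c₀ c y x := by
  have : tableMul b c₀ c = (tableMul b c₀ c).flip := by
    refine b.ext fun o => b.ext fun o' => ?_
    rw [LinearMap.flip_apply, tableMul_basis, tableMul_basis]
    rcases o with _ | i <;> rcases o' with _ | j <;> try rfl
    simp only [basisProd, h.comm_const i j, h.comm i j]
  exact LinearMap.congr_fun (LinearMap.congr_fun this x) y

omit [Nontrivial ι] in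
/-- The associators of a multiplication table are constants. -/
theorem tableMul_assoc_basis (h : IsMultTable c₀ c) (i j k : ι) : ∃ s : A,
    tableMul b c₀ c (tableMul b c₀ c (b (some i)) (b (some j))) (b (some k)) -
      tableMul b c₀ c (b (some i)) (tableMul b c₀ c (b (some j)) (b (some k))) = s • b none := by
  have key : ∀ i j k, tableMul b c₀ c (b (some i)) (tableMul b c₀ c (b (some j)) (b (some k))) =
      (∑ l, c j k l * c₀ i l) • b none + (c₀ j k • b (some i) +
        ∑ m, (∑ l, c j k l * c i l m) • b (some m)) := by
    intro i j k
    rw [tableMul_basis]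
    simp only [basisProd, map_add, map_smul, map_sum, tableMul_basis, smul_add, Finset.smul_sum,
      Finset.sum_add_distrib, Finset.sum_smul, smul_smul]
    rw [Finset.sum_comm]
    abel
  refine ⟨∑ l, c i j l * c₀ k l - ∑ l, c j k l * c₀ i l, ?_⟩
  rw [tableMul_comm b h _ (b (some k)), key, key, sub_smul, add_sub_add_comm, add_eq_left,
    sub_eq_zero]
  have e : ∀ (a : A) (i : ι), a • b (some i) = ∑ m, (if i = m then a else 0) • b (some m) := by
    intro a i
    simp [ite_smul]
  rw [e (c₀ i j), e (c₀ j k), ← Finset.sum_add_distrib, ← Finset.sum_add_distrib]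
  refine Finset.sum_congr rfl fun m _ => ?_
  rw [← add_smul, ← add_smul]
  congr 1
  have := h.assoc i j k m
  simp only [assocDefect] at this
  linear_combination -this

/-- Associators of basis elements, hence all associators, are multiples of the unit. In the cocycle
identity `a(y,z,w) - (ay,z,w) + (a,yz,w) - (a,y,zw) + (a,y,z)w = 0` the three middle terms are
therefore constants, and for distinct variables `a`, `w` the coefficient of `a` isolates the scalar
`(y,z,w)`. -/
theorem tableMul_assoc (h : IsMultTable c₀ c) (x y z : M) :
    tableMul b c₀ c (tableMul b c₀ c x y) z = tableMul b c₀ c x (tableMul b c₀ c y z) := by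
  let _ : NonUnitalNonAssocRing M :=
    { mul := fun x y => tableMul b c₀ c x y
      left_distrib := fun x y z => map_add (tableMul b c₀ c x) y z
      right_distrib := fun x y z => LinearMap.map_add₂ (tableMul b c₀ c) x y z
      zero_mul := fun x => LinearMap.map_zero₂ (tableMul b c₀ c) x
      mul_zero := fun x => map_zero (tableMul b c₀ c x) }
  have mul_def : ∀ x y : M, x * y = tableMul b c₀ c x y := fun _ _ => rfl
  have hone : ∀ x : M, b none * x = x := fun x => tableMul_one_left b x
  have hone' : ∀ x : M, x * b none = x := fun x => (tableMul_comm b h _ _).trans (hone x)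
  -- As a trilinear map, the associator is determined by its values on the basis.
  let L : M →ₗ[A] M →ₗ[A] M →ₗ[A] M :=
    (tableMul b c₀ c).compr₂ (tableMul b c₀ c) -
      (LinearMap.llcomp A M M M).compl₁₂ (tableMul b c₀ c) (tableMul b c₀ c)
  have hL : ∀ x y z, L x y z = associator x y z := fun x y z => rfl
  have hbasis : ∀ o o' o'', ∃ s : A, L (b o) (b o') (b o'') = s • b none := by
    intro o o' o''
    rcases o with _ | i
    · exact ⟨0, by rw [hL, associator, hone, hone, sub_self, zero_smul]⟩
    rcases o' with _ | j
    · exact ⟨0, by rw [hL, associator, hone, hone', sub_self, zero_smul]⟩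
    rcases o'' with _ | k
    · exact ⟨0, by rw [hL, associator, hone', hone', sub_self, zero_smul]⟩
    exact tableMul_assoc_basis b h i j k
  have hcoord : ∀ (k : ι) (x y z : M), b.coord (some k) (L x y z) = 0 := by
    intro k
    have : L.compr₂ (LinearMap.llcomp A M M A (b.coord (some k))) = 0 := by
      refine b.ext fun o => b.ext fun o' => b.ext fun o'' => ?_
      obtain ⟨s, hs⟩ := hbasis o o' o''
      simp [hs]
    intro x y z
    exact LinearMap.congr_fun (LinearMap.congr_fun (LinearMap.congr_fun this x) y) z
  have hscal : ∀ x y z : M, ∃ s : A, L x y z = s • b none := by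
    intro x y z
    refine ⟨b.coord none (L x y z), b.ext_elem fun o => ?_⟩
    rcases o with _ | k
    · simp
    · simpa using hcoord k x y z
  have hzero : ∀ y z (k : ι), L y z (b (some k)) = 0 := by
    intro y z k
    have hc := associator_cocycle (b (some (otherIndex k))) y z (b (some k))
    obtain ⟨s, hs⟩ := hscal y z (b (some k))
    obtain ⟨s', hs'⟩ := hscal (b (some (otherIndex k))) y z
    simp only [← hL] at hc
    -- Of the two outer terms, `s • x_{k'}` has coefficient `s` at `x_{k'}`, while `s' • x_k` has
    -- coefficient zero because `k' = otherIndex k` differs from `k`.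
    have hc' := congrArg (b.coord (some (otherIndex k))) hc
    simp only [map_add, map_sub, hcoord] at hc'
    rw [hs, hs', mul_def, mul_def, map_smul, LinearMap.map_smul₂, ← mul_def, ← mul_def, hone,
      hone'] at hc'
    have : s = 0 := by simpa [(otherIndex_ne k).symm, otherIndex_ne k] using hc'
    rw [hs, this, zero_smul]
  have : L x y = 0 := by
    refine b.ext fun o => ?_
    rcases o with _ | k
    · rw [hL, associator, hone', hone', sub_self, LinearMap.zero_apply]
    · exact hzero x y k
  exact sub_eq_zero.mp (LinearMap.congr_fun this z)

end

end MultTable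

/-! ### Multiplication tables and commutative algebras -/

section MultTable

variable {ι A M : Type*} [Fintype ι] [CommRing A] [Nontrivial ι] [DecidableEq ι]
  [AddCommGroup M] [Module A M]

/-- The commutative ring defined by a multiplication table. -/
abbrev tableRing (b : Module.Basis (Option ι) A M) {c₀ : ι → ι → A} {c : ι → ι → ι → A}
    (h : IsMultTable c₀ c) : CommRing M :=
  { (inferInstance : AddCommGroup M) with
    mul := fun x y => tableMul b c₀ c x y
    one := b none
    left_distrib := fun x y z => map_add (tableMul b c₀ c x) y z
    right_distrib := fun x y z => LinearMap.map_add₂ (tableMul b c₀ c) x y z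
    zero_mul := fun x => LinearMap.map_zero₂ (tableMul b c₀ c) x
    mul_zero := fun x => map_zero (tableMul b c₀ c x)
    mul_assoc := tableMul_assoc b h
    one_mul := tableMul_one_left b
    mul_one := fun x => (tableMul_comm b h _ _).trans (tableMul_one_left b x)
    mul_comm := tableMul_comm b h }

/-- A multiplication table is realized by a commutative algebra. -/
theorem IsMultTable.exists_algebra.{u, v} {ι : Type u} {A : Type v} [Fintype ι] [CommRing A]
    [Nontrivial ι] [DecidableEq ι] {c₀ : ι → ι → A} {c : ι → ι → ι → A} (h : IsMultTable c₀ c) :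
    ∃ (Q : Type (max u v)) (_ : CommRing Q) (_ : Algebra A Q) (b : Module.Basis (Option ι) A Q),
      b none = 1 ∧ ∀ i j, b (some i) * b (some j) =
        algebraMap A Q (c₀ i j) + ∑ k, c i j k • b (some k) := by
  let b : Module.Basis (Option ι) A (Option ι →₀ A) := Finsupp.basisSingleOne
  let R := tableRing b h
  let alg : @Algebra A (Option ι →₀ A) _ R.toSemiring :=
    @Algebra.ofModule A (Option ι →₀ A) _ R.toSemiring _
      (fun r x y => LinearMap.map_smul₂ (tableMul b c₀ c) r x y)
      (fun r x y => map_smul (tableMul b c₀ c x) r y)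
  refine ⟨Option ι →₀ A, R, alg, b, rfl, fun i j => ?_⟩
  refine (tableMul_basis b (some i) (some j)).trans ?_
  rfl

omit [Nontrivial ι] in
/-- The structure constants of a commutative algebra form a multiplication table. -/
theorem IsMultTable.of_basis {Q : Type*} [CommRing Q] [Algebra A Q]
    (b : Module.Basis (Option ι) A Q) (hb : b none = 1) {c₀ : ι → ι → A} {c : ι → ι → ι → A}
    (h : ∀ i j, b (some i) * b (some j) =
      algebraMap A Q (c₀ i j) + ∑ k, c i j k • b (some k)) : IsMultTable c₀ c := by
  have hn : ∀ a, algebraMap A Q a = a • b none := fun a => by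
    rw [hb, Algebra.algebraMap_eq_smul_one]
  have h0 : ∀ i j, b.repr (b (some i) * b (some j)) none = c₀ i j := fun i j => by
    simp [h, hn]
  have h1 : ∀ i j k, b.repr (b (some i) * b (some j)) (some k) = c i j k := fun i j k => by
    simp [h, hn, Finsupp.single_apply]
  refine ⟨fun i j => ?_, fun i j k => ?_, fun i j k m => ?_⟩
  · rw [← h0, ← h0, mul_comm]
  · rw [← h1, ← h1, mul_comm]
  · have key : ∀ i j k, b.repr (b (some i) * (b (some j) * b (some k))) (some m) =
        (if i = m then c₀ j k else 0) + ∑ l, c j k l * c i l m := by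
      intro i j k
      rw [h j k, mul_add, mul_comm (b (some i)) (algebraMap A Q _), ← Algebra.smul_def,
        Finset.mul_sum]
      simp only [mul_smul_comm, map_add, map_smul, map_sum, Finsupp.add_apply, Finsupp.smul_apply,
        Finsupp.finsetSum_apply, h1, smul_eq_mul]
      simp [Finsupp.single_apply]
    -- Commutativity turns `x_i (x_j x_k)` into `x_k (x_i x_j)`, so the same expansion gives both
    -- sides of the associativity relation.
    have e := key i j k
    rw [mul_left_comm, mul_comm (b (some i)) (b (some k)), mul_left_comm, mul_comm (b (some j)),
      key k i j] at e
    simp only [assocDefect]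
    linear_combination -e

end MultTable

/-! ### Symmetric ideals and normalized tables -/

section TableIdeal

variable {d : ℕ} {A : Type*} [CommRing A]

open MvPolynomial

/-- The relation `(x_i - t_i) (x_j - t_j) = c₀ i j + ∑ k, c i j k (x_k - t_k)`. -/
def tableRel (t : Fin d → A) (c₀ : Fin d → Fin d → A) (c : Fin d → Fin d → Fin d → A)
    (p : Fin d × Fin d) : MvPolynomial (Fin d) A :=
  (X p.1 - C (t p.1)) * (X p.2 - C (t p.2)) -
    (C (c₀ p.1 p.2) + ∑ k, C (c p.1 p.2 k) * (X k - C (t k)))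

/-- The ideal of the polynomial ring generated by the relations of a multiplication table in the
translated coordinates `x_i - t_i`. -/
def tableIdeal (t : Fin d → A) (c₀ : Fin d → Fin d → A) (c : Fin d → Fin d → Fin d → A) :
    Ideal (MvPolynomial (Fin d) A) :=
  Ideal.span (Set.range (tableRel t c₀ c))

theorem tableIdeal_map {B : Type*} [CommRing B] (f : A →+* B) (t : Fin d → A)
    (c₀ : Fin d → Fin d → A) (c : Fin d → Fin d → Fin d → A) :
    (tableIdeal t c₀ c).map (MvPolynomial.map f) =
      tableIdeal (fun i => f (t i)) (fun i j => f (c₀ i j)) (fun i j k => f (c i j k)) := by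
  rw [tableIdeal, tableIdeal, Ideal.map_span, ← Set.range_comp]
  congr 2
  funext p
  simp [tableRel]

theorem tableIdeal_le_iff {t : Fin d → A} {c₀ : Fin d → Fin d → A}
    {c : Fin d → Fin d → Fin d → A} {I : Ideal (MvPolynomial (Fin d) A)} :
    tableIdeal t c₀ c ≤ I ↔ ∀ i j, tableRel t c₀ c (i, j) ∈ I := by
  rw [tableIdeal, Ideal.span_le]
  simp [Set.range_subset_iff]

theorem quotient_smul_eq {I : Ideal (MvPolynomial (Fin d) A)} (a : A)
    (x : MvPolynomial (Fin d) A ⧸ I) : a • x = Ideal.Quotient.mk I (C a) * x := by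
  obtain ⟨p, rfl⟩ := Ideal.Quotient.mk_surjective x
  rw [← map_mul, ← smul_eq_C_mul]
  rfl

/-- The basis `1, x_1, …, x_d` of the quotient by a symmetric ideal. -/
def IsSymmetric.basis {I : Ideal (MvPolynomial (Fin d) A)} (h : IsSymmetric I) :
    Module.Basis (Option (Fin d)) A (MvPolynomial (Fin d) A ⧸ I) :=
  Module.Basis.mk h.linearIndependent h.span_eq_top.ge

theorem IsSymmetric.basis_none {I : Ideal (MvPolynomial (Fin d) A)} (h : IsSymmetric I) :
    h.basis none = 1 := by
  simp [IsSymmetric.basis, oneAndCoords]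

theorem IsSymmetric.basis_some {I : Ideal (MvPolynomial (Fin d) A)} (h : IsSymmetric I)
    (i : Fin d) : h.basis (some i) = Ideal.Quotient.mk I (X i) := by
  simp [IsSymmetric.basis, oneAndCoords]

/-- The projection between the quotients carries one basis to the other, so it is injective. -/
theorem IsSymmetric.eq_of_le {I J : Ideal (MvPolynomial (Fin d) A)} (hI : IsSymmetric I)
    (hJ : IsSymmetric J) (h : J ≤ I) : J = I := by
  let φ : (MvPolynomial (Fin d) A ⧸ J) →ₐ[A] (MvPolynomial (Fin d) A ⧸ I) :=
    Ideal.Quotient.factorₐ A h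
  have hφ : φ.toLinearMap = (hJ.basis.equiv hI.basis (Equiv.refl _)).toLinearMap := by
    refine hJ.basis.ext fun o => ?_
    rcases o with _ | i
    · rw [LinearEquiv.coe_coe, Module.Basis.equiv_apply, Equiv.refl_apply, hI.basis_none,
        hJ.basis_none]
      exact map_one φ
    · rw [LinearEquiv.coe_coe, Module.Basis.equiv_apply]
      simp [IsSymmetric.basis_some, φ]
  refine le_antisymm h fun p hp => ?_
  rw [← Ideal.Quotient.eq_zero_iff_mem] at hp ⊢
  refine (hJ.basis.equiv hI.basis (Equiv.refl _)).injective ?_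
  have := LinearMap.congr_fun hφ (Ideal.Quotient.mk J p)
  rw [map_zero]
  exact this.symm.trans hp

/-- The hypothesis makes the span stable under multiplication by every variable, and it contains 1.
-/
theorem span_oneAndCoords_eq_top {I : Ideal (MvPolynomial (Fin d) A)}
    (h : ∀ i j, Ideal.Quotient.mk I (X i * X j) ∈
      Submodule.span A (Set.range (oneAndCoords I))) :
    Submodule.span A (Set.range (oneAndCoords I)) = ⊤ := by
  set N := Submodule.span A (Set.range (oneAndCoords I)) with hN
  have hX : ∀ i, Ideal.Quotient.mk I (X i) ∈ N := fun i => Submodule.subset_span ⟨some i, rfl⟩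
  have h1 : (1 : MvPolynomial (Fin d) A ⧸ I) ∈ N := Submodule.subset_span ⟨none, rfl⟩
  have hmul : ∀ i, ∀ x ∈ N, x * Ideal.Quotient.mk I (X i) ∈ N := by
    intro i x hx
    induction hx using Submodule.span_induction with
    | mem x hx =>
      obtain ⟨o, rfl⟩ := hx
      rcases o with _ | j
      · simpa [oneAndCoords] using hX i
      · simpa [oneAndCoords] using h j i
    | zero => simp
    | add x y _ _ hx hy => rw [add_mul]; exact N.add_mem hx hy
    | smul a x _ hx => rw [smul_mul_assoc]; exact N.smul_mem a hx
  rw [eq_top_iff]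
  rintro x -
  obtain ⟨p, rfl⟩ := Ideal.Quotient.mk_surjective x
  induction p using MvPolynomial.induction_on with
  | C a =>
    have := N.smul_mem a h1
    rwa [← Algebra.algebraMap_eq_smul_one] at this
  | add p q hp hq => rw [map_add]; exact N.add_mem hp hq
  | mul_X p i hp => rw [map_mul]; exact hmul i _ hp

/-- If `1, b_i` is a basis of an algebra, then so is `1, b_i + t_i`. -/
theorem linearIndependent_translate {ι Q : Type*} [Fintype ι] [CommRing Q] [Algebra A Q]
    (b : Module.Basis (Option ι) A Q) (hb : b none = 1) (t : ι → A)
    {v : Option ι → Q} (h0 : v none = 1) (hv : ∀ i, v (some i) = b (some i) + algebraMap A Q (t i)) :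
    LinearIndependent A v := by
  classical
  rw [Fintype.linearIndependent_iff]
  intro g hg
  have hn : ∀ a, algebraMap A Q a = a • b none := fun a => by
    rw [hb, Algebra.algebraMap_eq_smul_one]
  rw [Fintype.sum_option, h0, ← hb] at hg
  simp only [hv, hn] at hg
  have hs : ∀ i, g (some i) = 0 := fun i => by
    simpa [Finsupp.single_apply] using DFunLike.congr_fun (congrArg b.repr hg) (some i)
  intro o
  rcases o with _ | i
  · simpa [Finsupp.single_apply, hs] using DFunLike.congr_fun (congrArg b.repr hg) none
  · exact hs i

/-- The relations reduce every product of two variables to the span. There are no hidden linear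
relations because the quotient maps to the algebra realizing the table, where the images are a
translated basis. -/
theorem IsMultTable.isSymmetric [Nontrivial (Fin d)] (t : Fin d → A) {c₀ : Fin d → Fin d → A}
    {c : Fin d → Fin d → Fin d → A} (h : IsMultTable c₀ c) :
    IsSymmetric (tableIdeal t c₀ c) := by
  constructor
  · obtain ⟨Q, _, _, b, hb, hmul⟩ := h.exists_algebra
    let φ : MvPolynomial (Fin d) A →ₐ[A] Q :=
      aeval fun i => b (some i) + algebraMap A Q (t i)
    have hφ : ∀ p ∈ tableIdeal t c₀ c, φ p = 0 := by
      have : tableIdeal t c₀ c ≤ RingHom.ker φ := by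
        rw [tableIdeal_le_iff]
        intro i j
        simp [RingHom.mem_ker, tableRel, φ, hmul, ← Algebra.smul_def]
      exact this
    refine LinearIndependent.of_comp (Ideal.Quotient.liftₐ _ φ hφ).toLinearMap ?_
    refine linearIndependent_translate b hb t ?_ fun i => ?_
    · exact map_one (Ideal.Quotient.liftₐ _ φ hφ)
    · exact aeval_X _ i
  · refine span_oneAndCoords_eq_top fun i j => ?_
    set I := tableIdeal t c₀ c
    set N := Submodule.span A (Set.range (oneAndCoords I))
    have hX : ∀ i, Ideal.Quotient.mk I (X i) ∈ N := fun i => Submodule.subset_span ⟨some i, rfl⟩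
    have h1 : (1 : MvPolynomial (Fin d) A ⧸ I) ∈ N := Submodule.subset_span ⟨none, rfl⟩
    have hrel := Ideal.Quotient.eq_zero_iff_mem.mpr
      ((tableIdeal_le_iff (I := I)).mp le_rfl i j)
    have e : Ideal.Quotient.mk I (X i * X j) = t j • Ideal.Quotient.mk I (X i) +
        t i • Ideal.Quotient.mk I (X j) - (t i * t j) • 1 + c₀ i j • 1 +
        ∑ k, c i j k • (Ideal.Quotient.mk I (X k) - t k • 1) := by
      simp only [tableRel, map_sub, map_mul, map_add, map_sum] at hrel
      simp only [quotient_smul_eq, map_mul, mul_one] at hrel ⊢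
      linear_combination hrel
    rw [e]
    refine N.add_mem (N.add_mem (N.sub_mem (N.add_mem ?_ ?_) ?_) ?_)
      (N.sum_mem fun k _ => N.smul_mem _ (N.sub_mem (hX k) (N.smul_mem _ h1)))
    · exact N.smul_mem _ (hX i)
    · exact N.smul_mem _ (hX j)
    · exact N.smul_mem _ h1
    · exact N.smul_mem _ h1

/-- The coordinates of a product of two variables in the quotient by the ideal of a table. -/
theorem IsSymmetric.repr_mul {t : Fin d → A} {c₀ : Fin d → Fin d → A}
    {c : Fin d → Fin d → Fin d → A} {I : Ideal (MvPolynomial (Fin d) A)} (hI : IsSymmetric I)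
    (h : tableIdeal t c₀ c ≤ I) (i j k : Fin d) :
    hI.basis.repr (Ideal.Quotient.mk I (X i * X j)) (some k) =
      c i j k + (if j = k then t i else 0) + (if i = k then t j else 0) := by
  have hrel := Ideal.Quotient.eq_zero_iff_mem.mpr (tableIdeal_le_iff.mp h i j)
  have e : Ideal.Quotient.mk I (X i * X j) = t j • hI.basis (some i) +
      t i • hI.basis (some j) + (c₀ i j - t i * t j) • hI.basis none +
      ∑ k, c i j k • (hI.basis (some k) - t k • hI.basis none) := by
    simp only [tableRel, map_sub, map_mul, map_add, map_sum] at hrel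
    simp only [hI.basis_none, hI.basis_some, quotient_smul_eq, map_mul, map_sub, mul_one]
    linear_combination hrel
  rw [e]
  simp [Finsupp.single_apply]
  ring

/-- The table and the translation are determined by the ideal, if the table is normalized. -/
theorem IsSymmetric.table_unique {t t' : Fin d → A} {c₀ c₀' : Fin d → Fin d → A}
    {c c' : Fin d → Fin d → Fin d → A} {I : Ideal (MvPolynomial (Fin d) A)}
    (h2 : IsUnit (2 : A)) (hI : IsSymmetric I) (h : tableIdeal t c₀ c ≤ I)
    (h' : tableIdeal t' c₀' c' ≤ I) (hc : ∀ k, c k k k = 0) (hc' : ∀ k, c' k k k = 0) :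
    t = t' ∧ c = c' := by
  have e : ∀ i j k, c i j k + (if j = k then t i else 0) + (if i = k then t j else 0) =
      c' i j k + (if j = k then t' i else 0) + (if i = k then t' j else 0) := fun i j k => by
    rw [← hI.repr_mul h, hI.repr_mul h']
  have ht : t = t' := by
    -- At `i = j = k` the normalization leaves `2 t k = 2 t' k`.
    funext k
    have := e k k k
    rw [hc, hc', if_pos rfl, if_pos rfl] at this
    exact h2.mul_left_cancel (by linear_combination this)
  subst ht
  refine ⟨rfl, ?_⟩
  funext i j k
  exact add_right_cancel (add_right_cancel (e i j k))

/-- A symmetric ideal is the ideal of a normalized multiplication table. -/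
theorem IsSymmetric.exists_table [Nontrivial (Fin d)] {I : Ideal (MvPolynomial (Fin d) A)}
    (h2 : IsUnit (2 : A)) (hI : IsSymmetric I) :
    ∃ (t : Fin d → A) (c : Fin d → Fin d → Fin d → A), IsSolution c ∧ (∀ k, c k k k = 0) ∧
      tableIdeal t (constCoeff c) c = I := by
  obtain ⟨u, hu⟩ := h2
  let π := Ideal.Quotient.mk I
  -- Completing the square: half the coefficient of `x_k` in `x_k²`.
  let t : Fin d → A := fun k => ↑u⁻¹ * hI.basis.repr (π (X k * X k)) (some k)
  let v : Option (Fin d) → MvPolynomial (Fin d) A ⧸ I := fun o => o.elim 1 fun i => π (X i - C (t i))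
  have hC : ∀ a : A, π (C a) = algebraMap A _ a := fun a => rfl
  have hv : LinearIndependent A v := by
    refine linearIndependent_translate hI.basis hI.basis_none (fun i => - t i) rfl fun i => ?_
    rw [hI.basis_some, map_neg, ← sub_eq_add_neg, ← hC, ← map_sub]
    rfl
  have hspan : ⊤ ≤ Submodule.span A (Set.range v) := by
    rw [← hI.span_eq_top, Submodule.span_le]
    have h1 : 1 ∈ Submodule.span A (Set.range v) := Submodule.subset_span ⟨none, rfl⟩
    rintro _ ⟨o, rfl⟩
    rcases o with _ | i
    · exact h1
    · have hi : v (some i) ∈ Submodule.span A (Set.range v) := Submodule.subset_span ⟨some i, rfl⟩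
      have := Submodule.add_mem _ hi (Submodule.smul_mem _ (t i) h1)
      rw [← Algebra.algebraMap_eq_smul_one, ← hC] at this
      simpa [v, π, oneAndCoords] using this
  let b := Module.Basis.mk hv hspan
  have hb0 : b none = 1 := by simp [b, v]
  have hb : ∀ i, b (some i) = π (X i - C (t i)) := fun i => by simp [b, v]
  let c : Fin d → Fin d → Fin d → A := fun i j k => b.repr (b (some i) * b (some j)) (some k)
  let c₀ : Fin d → Fin d → A := fun i j => b.repr (b (some i) * b (some j)) none
  have hmul : ∀ i j, b (some i) * b (some j) =
      algebraMap A _ (c₀ i j) + ∑ k, c i j k • b (some k) := by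
    intro i j
    conv_lhs => rw [← b.sum_repr (b (some i) * b (some j))]
    rw [Fintype.sum_option, hb0, ← Algebra.algebraMap_eq_smul_one]
  have hT : IsMultTable c₀ c := IsMultTable.of_basis b hb0 hmul
  have hle : tableIdeal t c₀ c ≤ I := by
    rw [tableIdeal_le_iff]
    intro i j
    rw [← Ideal.Quotient.eq_zero_iff_mem]
    have := hmul i j
    simp only [hb, ← hC, quotient_smul_eq] at this
    simp only [tableRel, map_sub, map_mul, map_add, map_sum] at this ⊢
    rw [sub_eq_zero]
    exact this
  refine ⟨t, c, hT.isSolution, fun k => ?_, ?_⟩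
  · have := hI.repr_mul hle k k k
    rw [if_pos rfl] at this
    have h3 : t k + t k = hI.basis.repr (π (X k * X k)) (some k) := by
      rw [← two_mul, ← hu]
      simp [t]
    rw [add_assoc, h3] at this
    exact left_eq_add.mp (this.trans (add_comm _ _))
  · rw [hT.constCoeff_eq]
    exact hI.eq_of_le (hT.isSymmetric t) hle

end TableIdeal

/-! ### Openness of the symmetric locus -/

section Open

/-- The support of the base change of a finite module is the preimage of its support. -/
theorem mem_support_baseChange {A B M : Type*} [CommRing A] [CommRing B] [Algebra A B]
    [AddCommGroup M] [Module A M] [Module.Finite A M] (q : PrimeSpectrum B) :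
    q ∈ Module.support B (B ⊗[A] M) ↔
      PrimeSpectrum.comap (algebraMap A B) q ∈ Module.support A M := by
  rw [Module.mem_support_iff_nontrivial_residueField_tensorProduct,
    Module.mem_support_iff_nontrivial_residueField_tensorProduct]
  set p := PrimeSpectrum.comap (algebraMap A B) q with hp
  have hpq : p.asIdeal = q.asIdeal.comap (algebraMap A B) := rfl
  -- The fibre at `q` is the fibre at `p` extended along the field extension `κ(p) → κ(q)`, which is
  -- faithfully flat.
  let _ : Algebra p.asIdeal.ResidueField q.asIdeal.ResidueField :=
    (Ideal.ResidueField.map p.asIdeal q.asIdeal (algebraMap A B) hpq).toAlgebra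
  have : IsScalarTower A p.asIdeal.ResidueField q.asIdeal.ResidueField := by
    refine IsScalarTower.of_algebraMap_eq fun x => ?_
    rw [RingHom.algebraMap_toAlgebra, Ideal.ResidueField.map_algebraMap,
      IsScalarTower.algebraMap_apply A B]
  let κ := q.asIdeal.ResidueField
  rw [(TensorProduct.AlgebraTensorModule.cancelBaseChange A B κ κ M).nontrivial_congr,
    ← (TensorProduct.AlgebraTensorModule.cancelBaseChange A p.asIdeal.ResidueField κ κ
      M).nontrivial_congr]
  exact Module.FaithfullyFlat.nontrivial_tensorProduct_iff_right p.asIdeal.ResidueField κ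

variable {d : ℕ} {A : Type*} [CommRing A] {I : Ideal (MvPolynomial (Fin d) A)}

/-- Generation gives a surjection from a free module of rank `d + 1` onto a projective module of the
same rank, which is bijective. -/
theorem HasColength.isSymmetric_iff (h : HasColength (d + 1) I) :
    IsSymmetric I ↔ Submodule.span A (Set.range (oneAndCoords I)) = ⊤ := by
  refine ⟨fun h => h.span_eq_top, fun hs => ⟨?_, hs⟩⟩
  have := h.finite
  have := h.projective
  have hsurj : Function.Surjective (Fintype.linearCombination A (oneAndCoords I)) := by
    rw [← LinearMap.range_eq_top, Fintype.range_linearCombination, hs]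
  refine linearIndependent_iff_injective_fintypeLinearCombination.mpr
    (Module.bijective_of_surjective_of_rankAtStalk_eq hsurj fun m hm => ?_).1
  have : Nontrivial A := ⟨0, 1, fun h0 => hm.ne_top ((Ideal.eq_top_iff_one m).mpr
    (h0 ▸ m.zero_mem))⟩
  rw [h.rank, Module.rankAtStalk_eq_finrank_of_free]
  simp

variable {B : Type*} [CommRing B] [Algebra A B]

theorem quotientBaseChange_oneAndCoords (o : Option (Fin d)) :
    quotientBaseChange (B := B) I (1 ⊗ₜ oneAndCoords I o) =
      oneAndCoords (I.map (MvPolynomial.map (algebraMap A B))) o := by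
  rcases o with _ | i
  · exact map_one (quotientBaseChange (B := B) I)
  · refine (quotientBaseChange_one_tmul_mk I _).trans ?_
    rw [MvPolynomial.map_X]
    rfl

/-- By right exactness of the tensor product, `N.baseChange B` is the kernel of the surjection onto
`B ⊗ (M ⧸ N)`. -/
theorem subsingleton_baseChange_quotient_iff {M : Type*} [AddCommGroup M] [Module A M]
    (N : Submodule A M) : Subsingleton (B ⊗[A] (M ⧸ N)) ↔ N.baseChange B = ⊤ := by
  have hex := lTensor_exact B (f := N.subtype) (g := N.mkQ)
    (LinearMap.exact_subtype_mkQ N) N.mkQ_surjective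
  have hsurj := LinearMap.lTensor_surjective B N.mkQ_surjective
  have hN : ∀ x, x ∈ N.baseChange B ↔ N.mkQ.lTensor B x = 0 := fun x => (hex x).symm
  constructor
  · intro _
    exact eq_top_iff.mpr fun x _ => (hN x).mpr (Subsingleton.elim _ _)
  · intro h
    refine subsingleton_of_forall_eq 0 fun y => ?_
    obtain ⟨x, rfl⟩ := hsurj y
    exact (hN x).mp (h ▸ Submodule.mem_top)

theorem span_oneAndCoords_map_eq_top_iff :
    Submodule.span B (Set.range (oneAndCoords (I.map (MvPolynomial.map (algebraMap A B))))) = ⊤ ↔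
      Subsingleton (B ⊗[A] ((MvPolynomial (Fin d) A ⧸ I) ⧸
        Submodule.span A (Set.range (oneAndCoords I)))) := by
  rw [subsingleton_baseChange_quotient_iff, Submodule.baseChange_span, ← Set.range_comp]
  have : oneAndCoords (I.map (MvPolynomial.map (algebraMap A B))) =
      (quotientBaseChange (B := B) I).toLinearEquiv ∘
        (TensorProduct.mk A B (MvPolynomial (Fin d) A ⧸ I) 1) ∘ oneAndCoords I :=
    funext fun o => (quotientBaseChange_oneAndCoords o).symm
  rw [this, Set.range_comp, ← LinearEquiv.coe_coe, ← Submodule.map_span]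
  rw [← LinearEquiv.range (quotientBaseChange (B := B) I).toLinearEquiv, ← Submodule.map_top]
  exact (Submodule.map_injective_of_injective
    (quotientBaseChange (B := B) I).toLinearEquiv.injective).eq_iff

/-- The open set is the complement of the support of the finite module `K` that measures the failure
to generate. Its formation commutes with base change, so `K ⊗ B = 0` exactly when `Spec B` avoids
the support. -/
theorem isOpenSubfunctor_symFunctor (d : ℕ) : IsOpenSubfunctor (symFunctor d) := by
  rintro A ⟨I, hI⟩
  have := hI.finite
  let K := (MvPolynomial (Fin d) A ⧸ I) ⧸ Submodule.span A (Set.range (oneAndCoords I))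
  refine ⟨⟨(Module.support A K)ᶜ, ?_⟩, fun B f => ?_⟩
  · rw [isOpen_compl_iff, Module.support_eq_zeroLocus]
    exact PrimeSpectrum.isClosed_zeroLocus _
  · change IsSymmetric (I.map (MvPolynomial.map f.hom.toRingHom)) ↔ _
    rw [(hI.map _).isSymmetric_iff]
    algebraize [f.hom.toRingHom]
    refine span_oneAndCoords_map_eq_top_iff.trans ?_
    rw [← Module.support_eq_empty_iff (R := B), Set.eq_empty_iff_forall_notMem,
      Set.range_subset_iff]
    exact forall_congr' fun q => not_congr (mem_support_baseChange q)

end Open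

/-! ### The universal multiplication table -/

section Universal

open MvPolynomial

variable (d : ℕ)

/-- The index set of the linear coefficients of a normalized multiplication table, that is, of
the coefficients of `x_k` in `x_i x_j` without those with `i = j = k`. -/
abbrev CoeffIndex : Type := Σ k : Fin d, {s : Sym2 (Fin d) // s ≠ s(k, k)}

theorem card_coeffIndex : Fintype.card (CoeffIndex d) = d * ((d + 1).choose 2 - 1) := by
  rw [Fintype.card_sigma]
  simp [Fintype.card_subtype_compl, Sym2.card]

/-- The enumeration of the linear coefficients by the variables of the polynomial ring. -/
def coeffEquiv : CoeffIndex d ≃ Fin (d * ((d + 1).choose 2 - 1)) :=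
  Fintype.equivFinOfCardEq (card_coeffIndex d)

/-- The linear coefficients of the universal normalized multiplication table. -/
def univCoeff (i j k : Fin d) : polyRing d :=
  if h : s(i, j) = s(k, k) then 0 else X (coeffEquiv d ⟨k, s(i, j), h⟩)

/-- The quadratic relations between the coefficients of a normalized multiplication table. -/
def quadRels : Set (polyRing d) :=
  {q | ∃ i j k m, m ≠ i ∧ m ≠ k ∧ q = assocDefect (univCoeff d) i j k m} ∪
  {q | ∃ i j k i', i ≠ k ∧ i' ≠ j ∧
    q = assocDefect (univCoeff d) i j k i - assocDefect (univCoeff d) i' k j i'}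

/-- The ideal generated by the quadratic relations. -/
def quadIdeal : Ideal (polyRing d) := Ideal.span (quadRels d)

variable {d}

theorem univCoeff_comm (i j k : Fin d) : univCoeff d i j k = univCoeff d j i k := by
  simp only [univCoeff, Sym2.eq_swap (a := i) (b := j)]

theorem univCoeff_self (k : Fin d) : univCoeff d k k k = 0 := by
  simp [univCoeff]

theorem univCoeff_isHomogeneous (i j k : Fin d) : (univCoeff d i j k).IsHomogeneous 1 := by
  unfold univCoeff
  split_ifs
  · exact isHomogeneous_zero _ _ _
  · exact isHomogeneous_X _ _

theorem assocDefect_univCoeff_isHomogeneous (i j k m : Fin d) :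
    (assocDefect (univCoeff d) i j k m).IsHomogeneous 2 :=
  (IsHomogeneous.sum _ _ _ fun _ _ =>
    (univCoeff_isHomogeneous _ _ _).mul (univCoeff_isHomogeneous _ _ _)).sub
  (IsHomogeneous.sum _ _ _ fun _ _ =>
    (univCoeff_isHomogeneous _ _ _).mul (univCoeff_isHomogeneous _ _ _))

theorem isHomogeneous_of_mem_quadRels {q : polyRing d} (hq : q ∈ quadRels d) :
    q.IsHomogeneous 2 := by
  rcases hq with ⟨i, j, k, m, -, -, rfl⟩ | ⟨i, j, k, i', -, -, rfl⟩
  · exact assocDefect_univCoeff_isHomogeneous _ _ _ _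
  · exact (assocDefect_univCoeff_isHomogeneous _ _ _ _).sub
      (assocDefect_univCoeff_isHomogeneous _ _ _ _)

theorem homogeneousComponent_mem_span {σ R : Type*} [CommRing R] {S : Set (MvPolynomial σ R)}
    {r : ℕ} (hS : ∀ q ∈ S, q.IsHomogeneous r) {p : MvPolynomial σ R} (hp : p ∈ Ideal.span S)
    (n : ℕ) : homogeneousComponent n p ∈ Ideal.span S := by
  let _ := gradedAlgebra (σ := σ) (R := R)
  have h := Ideal.homogeneous_span (homogeneousSubmodule σ R) S
    fun q hq => ⟨r, (mem_homogeneousSubmodule r q).mpr (hS q hq)⟩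
  rw [← decomposition.decompose'_apply]
  exact h n hp

/-- With two indices, `m ≠ i` and `m ≠ k` force `i = k`, where the defect vanishes by commutativity.
In the diagonal relations `j, k` determine `i, i'`, and the four remaining cases are identities. -/
theorem quadIdeal_two : quadIdeal 2 = ⊥ := by
  have hc := univCoeff_comm (d := 2) 1 0
  rw [quadIdeal, Ideal.span_eq_bot]
  rintro _ (⟨i, j, k, m, hi, hk, rfl⟩ | ⟨i, j, k, i', hi, hi', rfl⟩)
  · have : i = k := by omega
    subst this
    simp [assocDefect, univCoeff_comm]
  · fin_cases i <;> fin_cases j <;> fin_cases k <;> fin_cases i' <;>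
      simp [assocDefect, hc] at hi hi' ⊢ <;> ring

theorem quotient_univCoeff_isSolution : IsSolution fun i j k =>
    Ideal.Quotient.mk (quadIdeal d) (univCoeff d i j k) := by
  refine ⟨fun i j k => by rw [univCoeff_comm], fun i j k m hi hk => ?_,
    fun i j k i' hi hi' => ?_⟩
  · rw [assocDefect_map, Ideal.Quotient.eq_zero_iff_mem]
    exact Ideal.subset_span (Or.inl ⟨i, j, k, m, hi, hk, rfl⟩)
  · rw [assocDefect_map, assocDefect_map, ← sub_eq_zero, ← map_sub,
      Ideal.Quotient.eq_zero_iff_mem]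
    exact Ideal.subset_span (Or.inr ⟨i, j, k, i', hi, hi', rfl⟩)

theorem IsSolution.map {ι A B : Type*} [Fintype ι] [CommRing A] [CommRing B] (f : A →+* B)
    {c : ι → ι → ι → A} (h : IsSolution c) : IsSolution fun i j k => f (c i j k) := by
  refine ⟨fun i j k => by rw [h.comm], fun i j k m hi hk => ?_, fun i j k i' hi hi' => ?_⟩
  · rw [assocDefect_map, h.off_diag i j k m hi hk, map_zero]
  · rw [assocDefect_map, assocDefect_map, h.diag i j k i' hi hi']

variable {A : Type*} [CommRing A] [Algebra ℂ A]

theorem exists_quotient_algHom {c : Fin d → Fin d → Fin d → A} (h : IsSolution c)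
    (h0 : ∀ k, c k k k = 0) : ∃ f : (polyRing d ⧸ quadIdeal d) →ₐ[ℂ] A,
      ∀ i j k, f (Ideal.Quotient.mk _ (univCoeff d i j k)) = c i j k := by
  let v : CoeffIndex d → A := fun n =>
    Sym2.lift ⟨fun i j => c i j n.1, fun i j => h.comm i j _⟩ n.2.1
  let g : polyRing d →ₐ[ℂ] A := aeval fun n => v ((coeffEquiv d).symm n)
  have hg : ∀ i j k, g (univCoeff d i j k) = c i j k := by
    intro i j k
    unfold univCoeff
    split_ifs with hk
    · obtain ⟨rfl, rfl⟩ : i = k ∧ j = k := by simpa using hk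
      rw [map_zero, h0]
    · rw [aeval_X, Equiv.symm_apply_apply]
      rfl
  have hle : ∀ p ∈ quadIdeal d, g p = 0 := by
    have : quadIdeal d ≤ RingHom.ker g := by
      refine Ideal.span_le.mpr ?_
      have e : ∀ i j k m, g (assocDefect (univCoeff d) i j k m) = assocDefect c i j k m := by
        intro i j k m
        refine (assocDefect_map (g : polyRing d →+* A) _ i j k m).symm.trans ?_
        congr 1
        funext i j k
        exact hg i j k
      rintro _ (⟨i, j, k, m, hi, hk, rfl⟩ | ⟨i, j, k, i', hi, hi', rfl⟩)
      · exact (e i j k m).trans (h.off_diag i j k m hi hk)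
      · change g _ = 0
        rw [map_sub, e, e, h.diag i j k i' hi hi', sub_self]
    exact this
  exact ⟨Ideal.Quotient.liftₐ _ g hle, hg⟩

theorem quotient_algHom_ext {f g : (polyRing d ⧸ quadIdeal d) →ₐ[ℂ] A}
    (h : ∀ i j k, f (Ideal.Quotient.mk _ (univCoeff d i j k)) =
      g (Ideal.Quotient.mk _ (univCoeff d i j k))) : f = g := by
  refine Ideal.Quotient.algHom_ext _ (MvPolynomial.algHom_ext fun n => ?_)
  obtain ⟨⟨k, s, hs⟩, rfl⟩ := (coeffEquiv d).surjective n
  induction s using Sym2.ind with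
  | _ i j =>
    have := h i j k
    rwa [univCoeff, dif_neg hs] at this

variable (d)

/-- The coordinate ring of `ℂ^d × Spec (R_d / I_d)`. -/
abbrev univRing : Type := MvPolynomial (Fin d) ℂ ⊗[ℂ] (polyRing d ⧸ quadIdeal d)

variable {d}

/-- The linear coefficients of the universal multiplication table. -/
def univTable (i j k : Fin d) : univRing d :=
  Algebra.TensorProduct.includeRight (Ideal.Quotient.mk _ (univCoeff d i j k))

/-- The universal translation. -/
def univTranslation (i : Fin d) : univRing d :=
  Algebra.TensorProduct.includeLeft (S := ℂ) (X i : MvPolynomial (Fin d) ℂ)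

theorem univTable_isSolution : IsSolution (univTable (d := d)) :=
  quotient_univCoeff_isSolution.map
    (Algebra.TensorProduct.includeRight (R := ℂ) (A := MvPolynomial (Fin d) ℂ)).toRingHom

theorem univRing_algHom_ext {f g : univRing d →ₐ[ℂ] A}
    (ht : ∀ i, f (univTranslation i) = g (univTranslation i))
    (hc : ∀ i j k, f (univTable i j k) = g (univTable i j k)) : f = g :=
  Algebra.TensorProduct.ext (MvPolynomial.algHom_ext ht) (quotient_algHom_ext hc)

theorem exists_univRing_algHom (t : Fin d → A) {c : Fin d → Fin d → Fin d → A}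
    (h : IsSolution c) (h0 : ∀ k, c k k k = 0) : ∃ f : univRing d →ₐ[ℂ] A,
      (∀ i, f (univTranslation i) = t i) ∧ ∀ i j k, f (univTable i j k) = c i j k := by
  obtain ⟨g, hg⟩ := exists_quotient_algHom h h0
  refine ⟨Algebra.TensorProduct.productMap (aeval t) g, fun i => ?_, fun i j k => ?_⟩
  · simp [univTranslation]
  · simp [univTable, hg]

theorem IsSymmetric.hasColength {A : Type*} [CommRing A] {I : Ideal (MvPolynomial (Fin d) A)}
    (h : IsSymmetric I) : HasColength (d + 1) I := by
  have := Module.Free.of_basis h.basis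
  refine ⟨Module.Finite.of_basis h.basis, inferInstance, fun p => ?_⟩
  have : Nontrivial A := ⟨0, 1, fun h0 => p.2.ne_top ((Ideal.eq_top_iff_one _).mpr
    (h0 ▸ p.asIdeal.zero_mem))⟩
  have := Module.Finite.of_basis h.basis
  rw [Module.rankAtStalk_eq_finrank_of_free, Module.finrank_eq_card_basis h.basis]
  simp

variable [Nontrivial (Fin d)]

/-- The universal symmetric ideal. -/
def univIdeal : (symFunctor d).toFunctor.obj (CommAlgCat.of ℂ (univRing d)) :=
  have h : IsSymmetric (tableIdeal (univTranslation (d := d)) (constCoeff univTable) univTable) :=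
    univTable_isSolution.isMultTable.isSymmetric _
  ⟨⟨_, h.hasColength⟩, h⟩

theorem map_univIdeal {A : CommAlgCat.{0} ℂ} (f : CommAlgCat.of ℂ (univRing d) ⟶ A) :
    ((symFunctor d).toFunctor.map f univIdeal).1.1 =
      tableIdeal (fun i => f.hom (univTranslation i))
        (constCoeff fun i j k => f.hom (univTable i j k))
        (fun i j k => f.hom (univTable i j k)) := by
  refine (tableIdeal_map f.hom.toRingHom _ _ _).trans ?_
  congr 1
  funext i j
  exact (constCoeff_map f.hom.toRingHom _ i j).symm

/-- Injectivity is the uniqueness of the normalized table, surjectivity its existence; both use that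
2 is a unit in a `ℂ`-algebra. -/
theorem map_univIdeal_bijective (A : CommAlgCat.{0} ℂ) :
    Function.Bijective fun f : CommAlgCat.of ℂ (univRing d) ⟶ A =>
      (symFunctor d).toFunctor.map f univIdeal := by
  have h2 : IsUnit (2 : A) := by
    have := (IsUnit.mk0 (2 : ℂ) two_ne_zero).map (algebraMap ℂ A)
    rwa [map_ofNat] at this
  have hself : ∀ (f : CommAlgCat.of ℂ (univRing d) ⟶ A) k, f.hom (univTable k k k) = 0 := by
    intro f k
    simp [univTable, univCoeff_self]
  constructor
  · intro f g hfg
    have e := congrArg (fun I => I.1.1) hfg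
    have hf := map_univIdeal f
    have hg := map_univIdeal g
    obtain ⟨ht, hc⟩ := IsSymmetric.table_unique h2 ((symFunctor d).toFunctor.map f univIdeal).2
      hf.ge (hg.ge.trans e.ge) (hself f) (hself g)
    exact CommAlgCat.hom_ext (univRing_algHom_ext (congrFun ht)
      fun i j k => congrFun (congrFun (congrFun hc i) j) k)
  · rintro ⟨⟨I, hI⟩, hs⟩
    obtain ⟨t, c, hc, h0, rfl⟩ := IsSymmetric.exists_table h2 hs
    obtain ⟨f, hft, hfc⟩ := exists_univRing_algHom t hc h0
    refine ⟨CommAlgCat.ofHom f, Subtype.ext (Subtype.ext ?_)⟩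
    refine (map_univIdeal _).trans ?_
    simp only [CommAlgCat.hom_ofHom, hft, hfc]

end Universal

/-! ### Schemes over `ℂ` and their functors of points -/

section Schemes

/-- `Spec A` as a scheme over `ℂ`, for a `ℂ`-algebra `A`. -/
abbrev specAlg (A : CommAlgCat.{0} ℂ) : SchC := (algSpec (CommRingCat.of ℂ)).obj (.op A)

/-- The morphism of spectra induced by a homomorphism of `ℂ`-algebras. -/
abbrev specAlgMap {A B : CommAlgCat.{0} ℂ} (φ : A ⟶ B) : specAlg B ⟶ specAlg A :=
  (algSpec (CommRingCat.of ℂ)).map φ.op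

theorem exists_specAlgMap_eq {A B : CommAlgCat.{0} ℂ} (g : specAlg B ⟶ specAlg A) :
    ∃ φ : A ⟶ B, specAlgMap φ = g :=
  ⟨(algSpec.fullyFaithful.preimage g).unop, algSpec.fullyFaithful.map_preimage g⟩

theorem nonempty_iso_specAlg {Z : SchC} (hZ : IsAffine Z.left) :
    ∃ A : CommAlgCat.{0} ℂ, Nonempty (specAlg A ≅ Z) := by
  obtain ⟨A, ⟨e⟩⟩ := essImage_algSpec.mpr hZ
  exact ⟨A.unop, ⟨e⟩⟩

variable {X Y : SchC}

theorem comp_bijective_of_isAffine {f : X ⟶ Y}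
    (hf : ∀ A, Function.Bijective fun g : specAlg A ⟶ X => g ≫ f) {Z : SchC}
    (hZ : IsAffine Z.left) : Function.Bijective fun g : Z ⟶ X => g ≫ f := by
  obtain ⟨A, ⟨e⟩⟩ := nonempty_iso_specAlg hZ
  constructor
  · intro a b hab
    rw [← cancel_epi e.hom]
    refine (hf A).1 ?_
    simpa using hab
  · intro b
    obtain ⟨a, ha⟩ := (hf A).2 (e.hom ≫ b)
    refine ⟨e.inv ≫ a, ?_⟩
    simpa using congrArg (fun g => e.inv ≫ g) ha

theorem mono_left_of_comp_bijective {f : X ⟶ Y}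
    (hf : ∀ A, Function.Bijective fun g : specAlg A ⟶ X => g ≫ f) : Mono f.left := by
  refine ⟨fun {T} a b hab => ?_⟩
  have hX : a ≫ X.hom = b ≫ X.hom := by
    rw [← Over.w f, reassoc_of% hab]
  refine Scheme.Cover.hom_ext T.affineCover _ _ fun i => ?_
  let Z : SchC := Over.mk (T.affineCover.f i ≫ a ≫ X.hom)
  let a' : Z ⟶ X := Over.homMk (T.affineCover.f i ≫ a) (by simp [Z])
  let b' : Z ⟶ X := Over.homMk (T.affineCover.f i ≫ b) (by simp [Z, hX])
  have : a' = b' := by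
    refine (comp_bijective_of_isAffine hf (Z := Z) ?_).1 ?_
    · exact inferInstanceAs (IsAffine (T.affineCover.X i))
    · ext : 1
      simp [a', b', hab]
  exact congrArg (fun g => g.left) this

/-- A morphism of schemes over `ℂ` which is bijective on points with values in all `ℂ`-algebras is
an isomorphism. -/
theorem isIso_of_comp_bijective {f : X ⟶ Y}
    (hf : ∀ A, Function.Bijective fun g : specAlg A ⟶ X => g ≫ f) : IsIso f := by
  have := mono_left_of_comp_bijective hf
  have : IsIso ((Over.forget _).map f) := by
    refine (IsZariskiLocalAtTarget.iff_of_openCover (P := MorphismProperty.isomorphisms Scheme)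
      Y.left.affineCover).mpr fun i => ?_
    let Z : SchC := Over.mk (Y.left.affineCover.f i ≫ Y.hom)
    let c : Z ⟶ Y := Over.homMk (Y.left.affineCover.f i) rfl
    obtain ⟨s, hs⟩ := (comp_bijective_of_isAffine hf (Z := Z)
      (inferInstanceAs (IsAffine (Y.left.affineCover.X i)))).2 c
    have hs' : s.left ≫ f.left = Y.left.affineCover.f i := congrArg (fun g => g.left) hs
    -- Over an affine chart of `Y` the inclusion lifts to `X`, which gives a section of the base
    -- change of `f`. That base change is still a monomorphism, hence an isomorphism.
    have : IsSplitEpi (pullback.snd f.left (Y.left.affineCover.f i)) :=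
      ⟨⟨pullback.lift s.left (𝟙 _) (by rw [hs', Category.id_comp]), pullback.lift_snd _ _ _⟩⟩
    exact isIso_of_mono_of_isSplitEpi (pullback.snd f.left (Y.left.affineCover.f i))
  exact isIso_of_reflects_iso f (Over.forget _)

/-- Every point of a scheme over `ℂ` has an affine open neighborhood. -/
theorem exists_specAlg_openImmersion (X : SchC) (x : X.left) :
    ∃ (A : CommAlgCat.{0} ℂ) (g : specAlg A ⟶ X), IsOpenImmersion g.left ∧
      x ∈ Set.range g.left := by
  let i := X.left.affineCover.idx x
  let Z : SchC := Over.mk (X.left.affineCover.f i ≫ X.hom)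
  obtain ⟨A, ⟨e⟩⟩ := nonempty_iso_specAlg (Z := Z)
    (inferInstanceAs (IsAffine (X.left.affineCover.X i)))
  let c : Z ⟶ X := Over.homMk (X.left.affineCover.f i) rfl
  have : IsOpenImmersion c.left := inferInstanceAs (IsOpenImmersion (X.left.affineCover.f i))
  have he : IsIso e.hom.left := inferInstanceAs (IsIso ((Over.forget _).map e.hom))
  refine ⟨A, e.hom ≫ c, ?_, ?_⟩
  · rw [Over.comp_left]
    infer_instance
  · obtain ⟨y, hy⟩ := X.left.affineCover.covers x
    have hs : Function.Surjective e.hom.left := e.hom.left.surjective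
    obtain ⟨z, rfl⟩ := hs y
    exact ⟨z, hy⟩

/-- The canonical point `Spec κ(x) → X` as a morphism. -/
def residueMap (X : SchC) (x : X.left) : specAlg (residueAlg X x) ⟶ X := residuePoint X x

/-- The residue field extension of a morphism of schemes over `ℂ`. -/
theorem exists_residueMap_comp (f : X ⟶ Y) (x : X.left) :
    ∃ φ : residueAlg Y (f.left x) ⟶ residueAlg X x,
      specAlgMap φ ≫ residueMap Y (f.left x) = residueMap X x ≫ f := by
  let g : specAlg (residueAlg X x) ⟶ specAlg (residueAlg Y (f.left x)) :=
    Over.homMk (Spec.map (f.left.residueFieldMap x)) (by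
      have h1 := Over.w (residueMap Y (f.left x))
      have h2 := Over.w (residueMap X x)
      refine (congrArg (fun m => Spec.map (f.left.residueFieldMap x) ≫ m) h1.symm).trans ?_
      refine Eq.trans ?_ h2
      change _ ≫ Y.left.fromSpecResidueField _ ≫ _ = X.left.fromSpecResidueField _ ≫ _
      rw [Scheme.Hom.SpecMap_residueFieldMap_fromSpecResidueField_assoc, Over.w f])
  obtain ⟨φ, hφ⟩ := exists_specAlgMap_eq g
  refine ⟨φ, ?_⟩
  rw [hφ]
  ext : 1
  exact Scheme.Hom.SpecMap_residueFieldMap_fromSpecResidueField f.left x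

/-! ### Open subfunctors and open subschemes -/

variable {F : CommAlgCat.{0} ℂ ⥤ Type} {G : Subfunctor F}

/-- The element of `F(A)` defined by an `A`-valued point of `H`. -/
def evalPoint {H : SchC} (e : functorOfPoints H ⟶ F) {A : CommAlgCat.{0} ℂ}
    (f : specAlg A ⟶ H) : F.obj A := e.app A f

theorem evalPoint_comp {H : SchC} (e : functorOfPoints H ⟶ F) {A B : CommAlgCat.{0} ℂ}
    (φ : A ⟶ B) (f : specAlg A ⟶ H) : evalPoint e (specAlgMap φ ≫ f) = F.map φ (evalPoint e f) :=
  NatTrans.naturality_apply e φ f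

theorem evalPoint_bijective {H : SchC} (e : functorOfPoints H ≅ F) (A : CommAlgCat.{0} ℂ) :
    Function.Bijective (evalPoint e.hom : (specAlg A ⟶ H) → F.obj A) :=
  (e.app A).toEquiv.bijective

/-- The locus of points of `H` whose canonical point lies in a subfunctor of the functor of points
of `H`. -/
def pointLocus (G : Subfunctor F) {H : SchC} (e : functorOfPoints H ≅ F) : Set H.left :=
  {h | evalPoint e.hom (residueMap H h) ∈ G.obj (residueAlg H h)}

theorem subsingleton_primeSpectrum_residueAlg (X : SchC) (x : X.left) :
    Subsingleton (PrimeSpectrum (residueAlg X x)) :=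
  inferInstanceAs (Subsingleton (PrimeSpectrum (X.left.residueField x)))

theorem nonempty_primeSpectrum_residueAlg (X : SchC) (x : X.left) :
    Nonempty (PrimeSpectrum (residueAlg X x)) :=
  inferInstanceAs (Nonempty (PrimeSpectrum (X.left.residueField x)))

/-- Membership in an open subfunctor descends along a field extension: the spectrum of the smaller
field is one point, so an open set containing the image of the larger spectrum is everything. -/
theorem evalPoint_residueMap_comp_mem_iff (hG : IsOpenSubfunctor G) {H : SchC}
    (e : functorOfPoints H ≅ F) (f : X ⟶ H) (x : X.left) :
    evalPoint e.hom (residueMap X x ≫ f) ∈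
      G.obj (residueAlg X x) ↔ f.left x ∈ pointLocus G e := by
  obtain ⟨φ, hφ⟩ := exists_residueMap_comp f x
  rw [← hφ, evalPoint_comp]
  set y := evalPoint e.hom (residueMap H (f.left x))
  refine ⟨fun h => ?_, fun h => G.map φ h⟩
  obtain ⟨U, hU⟩ := hG _ y
  have h1 := (hU _ φ).mp h
  have := subsingleton_primeSpectrum_residueAlg H (f.left x)
  obtain ⟨q⟩ := nonempty_primeSpectrum_residueAlg X x
  have h2 := (hU _ (𝟙 _)).mpr (by
    rintro p -
    rw [Subsingleton.elim p (PrimeSpectrum.comap φ.hom.toRingHom q)]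
    exact h1 ⟨q, rfl⟩)
  rwa [F.map_id] at h2

/-- An open set of `Spec A` as in the definition of an open subfunctor is the preimage of the
locus. -/
theorem mem_opens_iff (hG : IsOpenSubfunctor G) {H : SchC} (e : functorOfPoints H ≅ F)
    {A : CommAlgCat.{0} ℂ} (f : specAlg A ⟶ H) {U : TopologicalSpace.Opens (PrimeSpectrum A)}
    (hU : ∀ (B : CommAlgCat.{0} ℂ) (φ : A ⟶ B), F.map φ (evalPoint e.hom f) ∈ G.obj B ↔
      Set.range (PrimeSpectrum.comap φ.hom.toRingHom) ⊆ U) (p : PrimeSpectrum A) :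
    p ∈ U ↔ f.left p ∈ pointLocus G e := by
  let p' : (specAlg A).left := p
  obtain ⟨φ, hφ⟩ := exists_specAlgMap_eq (residueMap (specAlg A) p')
  have hr : Set.range (PrimeSpectrum.comap φ.hom.toRingHom) = {p} := by
    have h1 := Scheme.range_fromSpecResidueField p'
    have h2 : (specAlgMap φ).left = (specAlg A).left.fromSpecResidueField p' :=
      congrArg (fun g => g.left) hφ
    rw [← h2] at h1
    exact h1
  rw [← evalPoint_residueMap_comp_mem_iff hG e f p', ← hφ, evalPoint_comp, hU, hr,
    Set.singleton_subset_iff]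
  rfl

theorem isOpen_pointLocus (hG : IsOpenSubfunctor G) {H : SchC} (e : functorOfPoints H ≅ F) :
    IsOpen (pointLocus G e) := by
  rw [isOpen_iff_forall_mem_open]
  intro h hh
  obtain ⟨A, g, hg, p, rfl⟩ := exists_specAlg_openImmersion H h
  obtain ⟨U, hU⟩ := hG A (evalPoint e.hom g)
  have key := mem_opens_iff hG e g hU
  refine ⟨g.left '' (U : Set (PrimeSpectrum A)), ?_, g.left.isOpenEmbedding.isOpenMap _ U.2,
    ⟨p, (key p).mpr hh, rfl⟩⟩
  rintro _ ⟨q, hq, rfl⟩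
  exact (key q).mp hq

theorem evalPoint_mem_iff_range_subset (hG : IsOpenSubfunctor G) {H : SchC}
    (e : functorOfPoints H ≅ F) {A : CommAlgCat.{0} ℂ} (f : specAlg A ⟶ H) :
    evalPoint e.hom f ∈ G.obj A ↔ Set.range f.left ⊆ pointLocus G e := by
  obtain ⟨U, hU⟩ := hG A (evalPoint e.hom f)
  have key := mem_opens_iff hG e f hU
  have h := hU A (𝟙 A)
  rw [F.map_id] at h
  refine h.trans ?_
  rw [Set.range_subset_iff, Set.range_subset_iff]
  exact forall_congr' fun p => key p

/-- An open subfunctor of the functor of points of `H` which is represented by the affine scheme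
`Spec S` is represented by an open subscheme of `H`. -/
theorem nonempty_openC_iso (hG : IsOpenSubfunctor G) {S : CommAlgCat.{0} ℂ}
    (α : functorOfPoints (specAlg S) ≅ G.toFunctor) {H : SchC} (e : functorOfPoints H ≅ F) :
    Nonempty (openC H ⟨pointLocus G e, isOpen_pointLocus hG e⟩ ≅ specAlg S) := by
  set V : H.left.Opens := ⟨pointLocus G e, isOpen_pointLocus hG e⟩ with hV
  let ι : openC H V ⟶ H := Over.homMk V.ι rfl
  have hι : Mono ι := by
    have : Mono ((Over.forget _).map ι) := inferInstanceAs (Mono V.ι)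
    exact (Over.forget _).mono_of_mono_map this
  have hrange : Set.range V.ι = pointLocus G e := by simp [hV]
  -- `y` is the `S`-point of `H` given by the universal element of `G`; it factors through the open
  -- locus.
  obtain ⟨y, hy⟩ := (evalPoint_bijective e S).2 (evalPoint α.hom (𝟙 (specAlg S))).1
  have hyV : Set.range y.left ⊆ Set.range V.ι := by
    rw [hrange, ← evalPoint_mem_iff_range_subset hG, hy]
    exact Subtype.prop _
  let l : (specAlg S).left ⟶ V.toScheme := IsOpenImmersion.lift V.ι y.left hyV
  have hl : l ≫ V.ι = y.left := IsOpenImmersion.lift_fac _ _ _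
  let j : specAlg S ⟶ openC H V := Over.homMk l (by
    change l ≫ V.ι ≫ H.hom = _
    rw [reassoc_of% hl, Over.w])
  have hj : j ≫ ι = y := by
    ext : 1
    exact hl
  have key : ∀ {A : CommAlgCat.{0} ℂ} (g : specAlg A ⟶ specAlg S),
      evalPoint e.hom (g ≫ y) = (evalPoint α.hom g).1 := by
    intro A g
    obtain ⟨φ, rfl⟩ := exists_specAlgMap_eq g
    have := evalPoint_comp α.hom φ (𝟙 (specAlg S))
    rw [Category.comp_id] at this
    rw [evalPoint_comp, hy, this]
    rfl
  have hbij : ∀ A, Function.Bijective fun g : specAlg A ⟶ specAlg S => g ≫ j := by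
    intro A
    constructor
    · intro a b hab
      have h1 : a ≫ y = b ≫ y := by
        rw [← hj, ← Category.assoc, ← Category.assoc]
        exact congrArg (fun g => g ≫ ι) hab
      exact (evalPoint_bijective α A).1 (Subtype.ext (by rw [← key, ← key, h1]))
    · intro b
      -- A point of the open subscheme has image in the locus, so it defines an element of `G`,
      -- which comes from a point of `Spec S`.
      have hb : evalPoint e.hom (b ≫ ι) ∈ G.obj A := by
        rw [evalPoint_mem_iff_range_subset hG, ← hrange]
        rintro _ ⟨p, rfl⟩
        exact ⟨b.left p, rfl⟩
      obtain ⟨a, ha⟩ := (evalPoint_bijective α A).2 ⟨_, hb⟩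
      refine ⟨a, ?_⟩
      change a ≫ j = b
      rw [← cancel_mono ι, Category.assoc, hj]
      exact (evalPoint_bijective e A).1 ((key a).trans (congrArg Subtype.val ha))
  have := isIso_of_comp_bijective hbij
  exact ⟨(asIso j).symm⟩

/-- The product of affine space and an affine scheme is affine. -/
theorem nonempty_prodC_iso (d : ℕ) (B : Type) [CommRing B] [Algebra ℂ B] :
    Nonempty (prodC (affineSpaceC d) (specC B) ≅
      specAlg (CommAlgCat.of ℂ (MvPolynomial (Fin d) ℂ ⊗[ℂ] B))) := by
  let a : 𝔸(Fin d; Spec (CommRingCat.of ℂ)) ⟶ Spec (CommRingCat.of ℂ) :=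
    𝔸(Fin d; Spec (CommRingCat.of ℂ)) ↘ Spec (CommRingCat.of ℂ)
  let b : Spec (CommRingCat.of B) ⟶ Spec (CommRingCat.of ℂ) :=
    Spec.map (CommRingCat.ofHom (algebraMap ℂ B))
  let a' : Spec (CommRingCat.of (MvPolynomial (Fin d) ℂ)) ⟶ Spec (CommRingCat.of ℂ) :=
    Spec.map (CommRingCat.ofHom (algebraMap ℂ (MvPolynomial (Fin d) ℂ)))
  let E : 𝔸(Fin d; Spec (CommRingCat.of ℂ)) ≅ Spec (CommRingCat.of (MvPolynomial (Fin d) ℂ)) :=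
    AffineSpace.SpecIso (Fin d) (CommRingCat.of ℂ)
  have hE : E.hom ≫ a' = a := by
    have : E.inv ≫ a = a' := AffineSpace.SpecIso_inv_over (CommRingCat.of ℂ)
    rw [← this, Iso.hom_inv_id_assoc]
  have h1 : a ≫ 𝟙 _ = E.hom ≫ a' := by rw [hE, Category.comp_id]
  have h2 : b ≫ 𝟙 _ = 𝟙 _ ≫ b := by rw [Category.id_comp, Category.comp_id]
  let p : pullback a b ≅ pullback a' b := asIso (pullback.map a b a' b E.hom (𝟙 _) (𝟙 _) h1 h2)
  let q : pullback a' b ≅ Spec (CommRingCat.of (MvPolynomial (Fin d) ℂ ⊗[ℂ] B)) :=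
    pullbackSpecIso ℂ (MvPolynomial (Fin d) ℂ) B
  have hq : q.hom ≫ Spec.map (CommRingCat.ofHom (algebraMap ℂ (MvPolynomial (Fin d) ℂ ⊗[ℂ] B))) =
      pullback.fst a' b ≫ a' := pullbackSpecIso_hom_base ℂ (MvPolynomial (Fin d) ℂ) B
  have h : (p ≪≫ q).hom ≫
      Spec.map (CommRingCat.ofHom (algebraMap ℂ (MvPolynomial (Fin d) ℂ ⊗[ℂ] B))) =
        pullback.fst a b ≫ a := by
    have hp : p.hom ≫ pullback.fst a' b = pullback.fst a b ≫ E.hom := pullback.lift_fst _ _ _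
    rw [Iso.trans_hom, Category.assoc, hq, reassoc_of% hp, hE]
  exact ⟨Over.isoMk (p ≪≫ q) h⟩

/-- The comparison of the functor represented by `S` with the functor of points of `Spec S`. -/
def coyonedaToPoints (S : CommAlgCat.{0} ℂ) :
    coyoneda.obj (.op S) ⟶ functorOfPoints (specAlg S) where
  app A := ↾fun φ => specAlgMap φ
  naturality A B φ := by
    ext ψ
    exact (algSpec (CommRingCat.of ℂ)).map_comp φ.op ψ.op

instance (S : CommAlgCat.{0} ℂ) : IsIso (coyonedaToPoints S) := by
  refine (NatTrans.isIso_iff_isIso_app _).mpr fun A => (isIso_iff_bijective _).mpr ⟨?_, ?_⟩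
  · intro φ ψ h
    exact Quiver.Hom.op_inj (algSpec.fullyFaithful.map_injective h)
  · exact exists_specAlgMap_eq

variable {d : ℕ} [Nontrivial (Fin d)]

instance : IsIso (coyonedaEquiv.symm (univIdeal (d := d))) :=
  (NatTrans.isIso_iff_isIso_app _).mpr fun A =>
    (isIso_iff_bijective _).mpr (map_univIdeal_bijective A)

/-- The symmetric ideals are represented by the spectrum of the universal ring. -/
def symFunctorRepr : functorOfPoints (specAlg (CommAlgCat.of ℂ (univRing d))) ≅
    (symFunctor d).toFunctor :=
  (asIso (coyonedaToPoints _)).symm ≪≫ asIso (coyonedaEquiv.symm univIdeal)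

end Schemes

end HilbertPoints

end

theorem mainTheorem5 (d : ℕ) (hd : 2 ≤ d) :
    ∃ I : Ideal (HilbertPoints.polyRing d),
      -- `I` is a homogeneous ideal
      (∀ p ∈ I, ∀ n : ℕ, MvPolynomial.homogeneousComponent n p ∈ I) ∧
      -- `I` is generated by quadratic forms
      (∃ S : Set (HilbertPoints.polyRing d), (∀ q ∈ S, q.IsHomogeneous 2) ∧ I = Ideal.span S) ∧
      (d = 2 → I = ⊥) ∧
      -- `V_d` as an open subfunctor of the Hilbert functor
      (HilbertPoints.IsOpenSubfunctor (HilbertPoints.symFunctor d) ∧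
        Nonempty ((HilbertPoints.symFunctor d).toFunctor ≅
          HilbertPoints.functorOfPoints (HilbertPoints.prodC (HilbertPoints.affineSpaceC d)
            (HilbertPoints.specC (HilbertPoints.polyRing d ⧸ I))))) ∧
      -- `V_d` as an open subscheme of the Hilbert scheme
      (∀ (H : HilbertPoints.SchC) (e : HilbertPoints.HilbertSchemeStructure d (d + 1) H),
        ∃ hU : IsOpen (HilbertPoints.symLocus e),
          Nonempty (HilbertPoints.openC H ⟨HilbertPoints.symLocus e, hU⟩ ≅
            HilbertPoints.prodC (HilbertPoints.affineSpaceC d)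
              (HilbertPoints.specC (HilbertPoints.polyRing d ⧸ I)))) := by
  have : Nontrivial (Fin d) := Fin.nontrivial_iff_two_le.mpr hd
  have hG := HilbertPoints.isOpenSubfunctor_symFunctor d
  obtain ⟨E⟩ := HilbertPoints.nonempty_prodC_iso d
    (HilbertPoints.polyRing d ⧸ HilbertPoints.quadIdeal d)
  refine ⟨HilbertPoints.quadIdeal d, fun p hp n =>
    HilbertPoints.homogeneousComponent_mem_span
      (fun q hq => HilbertPoints.isHomogeneous_of_mem_quadRels hq) hp n,
    ⟨HilbertPoints.quadRels d, fun q hq => HilbertPoints.isHomogeneous_of_mem_quadRels hq, rfl⟩,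
    ?_, ⟨hG, ⟨HilbertPoints.symFunctorRepr.symm ≪≫
      Functor.isoWhiskerLeft _ (yoneda.mapIso E.symm)⟩⟩, fun H e => ?_⟩
  · rintro rfl
    exact HilbertPoints.quadIdeal_two
  · obtain ⟨i⟩ := HilbertPoints.nonempty_openC_iso hG HilbertPoints.symFunctorRepr e
    -- `symLocus e` unfolds to `pointLocus` of the symmetric subfunctor.
    exact ⟨HilbertPoints.isOpen_pointLocus hG e, ⟨i ≪≫ E.symm⟩⟩
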